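/- For $n\ge 1$ let $$M_n^{[0,1]}=\Big\{\Big(\int_0^1 x\,\mu(dx),\dots,\int_0^1 x^n\,\mu(dx)\Big):\ \mu\text{ a probability measure on }[0,1]\Big\}\subset\mathbb R^n ,$$ and call uniform distribution on $M_n^{[0,1]}$ the normalized Lebesgue measure on this set. For a measure $\gamma$ on $[0,1]$ let $m_k(\gamma)=\int x^k\,\gamma(dx)$. For $\beta,a,b>0$ and $N\ge 0$ let $J(\beta,a,b,N)$ be the probability distribution on $[0,1]^N$ with density proportional to $$\prod_{1\le i<j\le N}|x_j-x_i|^{\beta}\ \prod_{k=1}^N x_k^{b-1}(1-x_k)^{a-1}$$ (for $N=0$, the unit mass at the single point). For $a_1,\dots,a_n>0$ let $\operatorname{Dir}(a_1,\dots,a_n)$ be the probability distribution on the simplex $\{x_i>0,\ x_1+\dots+x_n=1\}$ with density $$\frac{\Gamma(a_1+\dots+a_n)}{\Gamma(a_1)\cdots\Gamma(a_n)}\,x_1^{a_1-1}\cdots x_n^{a_n-1}$$ with respect to Lebesgue measure $dx_1\cdots dx_{n-1}$ on the simplex (for $n=1$, the unit mass at $1$), and let $\operatorname{Dir}_n(a)=\operatorname{Dir}(a,\dots,a)$.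 Let $N\ge 1$. 1. If $(x_1,\dots,x_N,w_1,\dots,w_N)$ has distribution $J(4,1,1,N)\otimes\operatorname{Dir}_N(2)$ and $\gamma=\sum_{k=1}^N w_k\delta_{x_k}$, then $(m_1(\gamma),\dots,m_{2N-1}(\gamma))$ is uniformly distributed on $M_{2N-1}^{[0,1]}$. 2. If $(x_1,\dots,x_N,w_0,\dots,w_N)$ has distribution $J(4,1,3,N)\otimes\operatorname{Dir}(1,2,\dots,2)$ (first parameter $1$, the $N$ others $2$) and $\gamma=w_0\delta_0+\sum_{k=1}^N w_k\delta_{x_k}$, then $(m_1(\gamma),\dots,m_{2N}(\gamma))$ is uniformly distributed on $M_{2N}^{[0,1]}$. 3. If $(x_1,\dots,x_{N-1},w_0,\dots,w_N)$ has distribution $J(4,3,3,N-1)\otimes\operatorname{Dir}(1,2,\dots,2,1)$ (first and last parameters $1$, the $N-1$ others $2$) and $\gamma=w_0\delta_0+\sum_{k=1}^{N-1} w_k\delta_{x_k}+w_N\delta_1$, then $(m_1(\gamma),\dots,m_{2N-1}(\gamma))$ is uniformly distributed on $M_{2N-1}^{[0,1]}$. 4. If $(x_1,\dots,x_N,w_1,\dots,w_{N+1})$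 has distribution $J(4,3,1,N)\otimes\operatorname{Dir}(2,\dots,2,1)$ (last parameter $1$, the $N$ others $2$) and $\gamma=\sum_{k=1}^N w_k\delta_{x_k}+w_{N+1}\delta_1$, then $(m_1(\gamma),\dots,m_{2N}(\gamma))$ is uniformly distributed on $M_{2N}^{[0,1]}$. -/

import Mathlib

open MeasureTheory ProbabilityTheory
open scoped ENNReal

noncomputable section

namespace RandomMoments

/-- The vector `(m₁(γ), …, mₙ(γ))` of the first `n` moments of a measure on the real line
(coordinate `k : Fin n` is the moment of order `k + 1`). -/
def moments (n : ℕ) (γ : Measure ℝ) : Fin n → ℝ :=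
  fun k => ∫ x, x ^ ((k : ℕ) + 1) ∂γ

/-- The `n`-th moment space of `[0,1]`: the vectors of the first `n` moments of all
probability measures carried by `[0,1]`. -/
def momentSpace (n : ℕ) : Set (Fin n → ℝ) :=
  {m | ∃ μ : Measure ℝ, IsProbabilityMeasure μ ∧ μ (Set.Icc (0 : ℝ) 1)ᶜ = 0 ∧ m = moments n μ}

/-- The uniform distribution on the `n`-th moment space: normalized Lebesgue measure. -/
def uniformMoments (n : ℕ) : Measure (Fin n → ℝ) :=
  cond volume (momentSpace n)

/-- The Vandermonde product `Δ(x₁, …, x_N) = ∏_{i < j} (x_j - x_i)`. -/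
def vandermondeProd {N : ℕ} (x : Fin N → ℝ) : ℝ :=
  ∏ i : Fin N, ∏ j ∈ Finset.Ioi i, (x j - x i)

/-- The unnormalized density `|Δ(x)|^β ∏ x_k^(b-1) (1 - x_k)^(a-1)`. -/
def jacobiWeight (β a b : ℝ) {N : ℕ} (x : Fin N → ℝ) : ℝ :=
  |vandermondeProd x| ^ β * ∏ k : Fin N, (x k ^ (b - 1) * (1 - x k) ^ (a - 1))

/-- The measure on the cube `[0,1]^N` with Lebesgue density `jacobiWeight β a b`. -/
def jacobiUnnormalized (β a b : ℝ) (N : ℕ) : Measure (Fin N → ℝ) :=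
  (volume.restrict (Set.univ.pi fun _ : Fin N => Set.Icc (0 : ℝ) 1)).withDensity
    fun x => ENNReal.ofReal (jacobiWeight β a b x)

/-- The Jacobi distribution `J(β, a, b, N)`: the probability distribution on `[0,1]^N` whose
density is proportional to `jacobiWeight β a b`. -/
def jacobi (β a b : ℝ) (N : ℕ) : Measure (Fin N → ℝ) :=
  (jacobiUnnormalized β a b N Set.univ)⁻¹ • jacobiUnnormalized β a b N

/-- Lebesgue measure on the open simplex `{x : Fin n → ℝ | 0 < x i, ∑ x i = 1}`, parametrized by
all coordinates but the last one. The simplex is empty for `n = 0`. -/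
def simplexVolume : (n : ℕ) → Measure (Fin n → ℝ)
  | 0 => 0
  | k + 1 =>
    (volume.restrict {x : Fin k → ℝ | (∀ i, 0 < x i) ∧ ∑ i, x i < 1}).map
      fun x => Fin.snoc (α := fun _ => ℝ) x (1 - ∑ i, x i)

/-- The Dirichlet distribution `Dir(a₁, …, aₙ)` on the simplex. -/
def dirichlet {n : ℕ} (a : Fin n → ℝ) : Measure (Fin n → ℝ) :=
  (simplexVolume n).withDensity fun x =>
    ENNReal.ofReal (Real.Gamma (∑ i, a i) / (∏ i, Real.Gamma (a i)) * ∏ i, x i ^ (a i - 1))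

/-- The point mass of weight `w` at `x`. -/
def atom (w x : ℝ) : Measure ℝ :=
  ENNReal.ofReal w • Measure.dirac x

end RandomMoments

end

/-
Take the nodes and all weights but one as coordinates. The Jacobian of the moment map is then a
confluent Vandermonde determinant, equal up to sign to `∏ w_l · Δ(x)^4 · ∏ (x_l - y_e)^2`, where
`y_e` are the atoms fixed at the endpoints: this is the product of the Jacobi and Dirichlet
densities up to a constant. On each ordering cell of the nodes the moment map is injective, since
a measure with few atoms is determined by its moments, and its image is the interior of the moment
space: configurations on the boundary of the cell are annihilated by a polynomial of degree at
most `n`, nonnegative on `[0,1]`, so their moments lie on the boundary of the moment space, and the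
interior of the moment space is connected. By the change of variables formula every cell is
therefore pushed forward to a constant multiple of Lebesgue measure on the moment space.
-/

namespace RandomMoments

section Vandermonde

variable {κ α β : Type*} [Fintype κ] [Fintype α] [Fintype β]
  [DecidableEq κ] [DecidableEq α] [DecidableEq β]

/-- The absolute discriminant of a finite family of reals: the product of the distances over all
ordered pairs of distinct indices, so that it is the square of the Vandermonde determinant. -/
def absDiscr (z : κ → ℝ) : ℝ :=
  ∏ a, ∏ b ∈ {a}ᶜ, |z a - z b|

theorem absDiscr_comp_equiv (e : α ≃ κ) (z : κ → ℝ) : absDiscr (z ∘ e) = absDiscr z := by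
  rw [absDiscr, absDiscr, ← e.prod_comp]
  refine Finset.prod_congr rfl fun a _ => Finset.prod_equiv e ?_ fun _ _ => rfl
  simp

theorem absDiscr_add_const (z : κ → ℝ) (h : ℝ) : absDiscr (fun a => z a + h) = absDiscr z := by
  simp only [absDiscr, add_sub_add_right_eq_sub]

theorem prod_compl_singleton_inl {M : Type*} [CommMonoid M] (a : α) (g : α ⊕ β → M) :
    ∏ b ∈ {Sum.inl a}ᶜ, g b = (∏ b ∈ {a}ᶜ, g (.inl b)) * ∏ b, g (.inr b) := by
  rw [← Finset.prod_disjSum]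
  congr 1
  ext b
  cases b <;> simp

theorem prod_compl_singleton_inr {M : Type*} [CommMonoid M] (b : β) (g : α ⊕ β → M) :
    ∏ c ∈ {Sum.inr b}ᶜ, g c = (∏ a, g (.inl a)) * ∏ c ∈ {b}ᶜ, g (.inr c) := by
  rw [← Finset.prod_disjSum]
  congr 1
  ext c
  cases c <;> simp

theorem absDiscr_sumElim (x : α → ℝ) (y : β → ℝ) :
    absDiscr (Sum.elim x y) = absDiscr x * absDiscr y * ∏ a, ∏ b, |x a - y b| ^ 2 := by
  have hyx : ∏ b, ∏ a, |y b - x a| = ∏ a, ∏ b, |x a - y b| := by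
    rw [Finset.prod_comm]
    simp only [abs_sub_comm]
  simp only [absDiscr, Fintype.prod_sum_type, prod_compl_singleton_inl, prod_compl_singleton_inr,
    Sum.elim_inl, Sum.elim_inr, Finset.prod_mul_distrib, Finset.prod_pow, hyx]
  ring

theorem vandermondeProd_eq_det {n : ℕ} (x : Fin n → ℝ) :
    vandermondeProd x = (Matrix.vandermonde x).det :=
  (Matrix.det_vandermonde x).symm

theorem vandermondeProd_ne_zero_iff {n : ℕ} {x : Fin n → ℝ} :
    vandermondeProd x ≠ 0 ↔ Function.Injective x := by
  rw [vandermondeProd_eq_det, Matrix.det_vandermonde_ne_zero_iff]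

theorem vandermondeProd_sq {n : ℕ} (x : Fin n → ℝ) : vandermondeProd x ^ 2 = absDiscr x := by
  rw [absDiscr, ← Finset.prod_prod_Ioi_mul_eq_prod_prod_off_diag fun j i => |x i - x j|,
    vandermondeProd, ← Finset.prod_pow]
  refine Finset.prod_congr rfl fun i _ => ?_
  rw [← Finset.prod_pow]
  refine Finset.prod_congr rfl fun j _ => ?_
  rw [abs_sub_comm (x i), abs_mul_abs_self, sq]

end Vandermonde

section ConfluentVandermonde

variable {κ α β : Type*}

/-- The Vandermonde matrix with `n` columns `z ^ 0, …, z ^ (n - 1)` and one row for each member of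
a family `z` of arbitrary size. -/
def powerMatrix (n : ℕ) (z : κ → ℝ) : Matrix κ (Fin n) ℝ :=
  Matrix.of fun i r => z i ^ (r : ℕ)

/-- The confluent Vandermonde matrix with double nodes `x` and simple nodes `y`: the derivatives
of the powers at the double nodes, followed by the powers at all nodes. -/
def confluentVandermonde (n : ℕ) (x : α → ℝ) (y : β → ℝ) : Matrix (α ⊕ (α ⊕ β)) (Fin n) ℝ :=
  Matrix.fromRows (Matrix.of fun l r => (r : ℝ) * x l ^ ((r : ℕ) - 1))
    (powerMatrix n (Sum.elim x y))

/-- The deformation of `confluentVandermonde` in which the derivatives are replaced by divided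
differences of step `h`, written as geometric sums so that `h = 0` is allowed. -/
def dividedVandermonde (n : ℕ) (x : α → ℝ) (y : β → ℝ) (h : ℝ) :
    Matrix (α ⊕ (α ⊕ β)) (Fin n) ℝ :=
  Matrix.fromRows
    (Matrix.of fun l r => ∑ i ∈ Finset.range r, (x l + h) ^ i * x l ^ ((r : ℕ) - 1 - i))
    (powerMatrix n (Sum.elim x y))

theorem dividedVandermonde_zero (n : ℕ) (x : α → ℝ) (y : β → ℝ) :
    dividedVandermonde n x y 0 = confluentVandermonde n x y := by
  simp only [dividedVandermonde, confluentVandermonde, add_zero, geom_sum₂_self]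

theorem continuous_dividedVandermonde (n : ℕ) (x : α → ℝ) (y : β → ℝ) :
    Continuous (dividedVandermonde n x y) := by
  refine continuous_matrix fun a r => ?_
  rcases a with l | i
  · simp only [dividedVandermonde, Matrix.fromRows_apply_inl, Matrix.of_apply]
    fun_prop
  · exact continuous_const

variable [Fintype κ] [Fintype α] [Fintype β] [DecidableEq κ] [DecidableEq α] [DecidableEq β]

theorem sq_det_powerMatrix {n : ℕ} (row : κ ≃ α) (col : κ ≃ Fin n) (z : α → ℝ) :
    ((powerMatrix n z).submatrix row col).det ^ 2 = absDiscr z := by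
  have hV : (powerMatrix n z).submatrix row col
      = (Matrix.vandermonde (z ∘ col.symm.trans row)).submatrix col col := by
    ext i r
    simp [powerMatrix]
  rw [hV, Matrix.det_submatrix_equiv_self, ← vandermondeProd_eq_det, vandermondeProd_sq,
    absDiscr_comp_equiv]

theorem powerMatrix_add_eq_mul_dividedVandermonde (n : ℕ) (x : α → ℝ) (y : β → ℝ) (h : ℝ) :
    powerMatrix n (Sum.elim (fun l => x l + h) (Sum.elim x y))
      = (Matrix.fromBlocks (Matrix.diagonal fun _ => h) (Matrix.fromCols 1 0) 0 1 :
          Matrix (α ⊕ (α ⊕ β)) (α ⊕ (α ⊕ β)) ℝ) * dividedVandermonde n x y h := by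
  rw [dividedVandermonde, Matrix.fromBlocks_mul_fromRows]
  ext a r
  rcases a with l | i
  · have hgeom := (Commute.all (x l + h) (x l)).geom_sum₂_mul (r : ℕ)
    rw [add_sub_cancel_left] at hgeom
    simp [powerMatrix, Matrix.mul_apply, Matrix.one_apply, Matrix.diagonal_apply,
      ← sub_eq_iff_eq_add, ← hgeom, mul_comm]
  · simp [powerMatrix]

theorem absDiscr_sumElim_add (x : α → ℝ) (y : β → ℝ) (h : ℝ) :
    absDiscr (Sum.elim (fun l => x l + h) (Sum.elim x y))
      = (h ^ Fintype.card α) ^ 2 * (absDiscr x * absDiscr (Sum.elim x y)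
        * ∏ l, ∏ i ∈ {Sum.inl l}ᶜ, |x l + h - Sum.elim x y i| ^ 2) := by
  have hsplit (l : α) : ∏ i, |x l + h - Sum.elim x y i| ^ 2
      = h ^ 2 * ∏ i ∈ {Sum.inl l}ᶜ, |x l + h - Sum.elim x y i| ^ 2 := by
    rw [← Finset.prod_mul_prod_compl {Sum.inl l}]
    simp
  rw [absDiscr_sumElim, absDiscr_add_const]
  simp only [hsplit, Finset.prod_mul_distrib, Finset.prod_const, Finset.card_univ]
  ring

theorem sq_det_dividedVandermonde {n : ℕ} (row : κ ≃ α ⊕ (α ⊕ β)) (col : κ ≃ Fin n) (x : α → ℝ)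
    (y : β → ℝ) {h : ℝ} (hh : h ≠ 0) :
    ((dividedVandermonde n x y h).submatrix row col).det ^ 2
      = absDiscr x * absDiscr (Sum.elim x y)
        * ∏ l, ∏ i ∈ {Sum.inl l}ᶜ, |x l + h - Sum.elim x y i| ^ 2 := by
  have hdet := sq_det_powerMatrix row col (Sum.elim (fun l => x l + h) (Sum.elim x y))
  rw [powerMatrix_add_eq_mul_dividedVandermonde, ← Matrix.submatrix_mul_equiv _ _ _ row,
    Matrix.det_mul, Matrix.det_submatrix_equiv_self, Matrix.det_fromBlocks_zero₂₁,
    Matrix.det_diagonal, Matrix.det_one, mul_one, Finset.prod_const, Finset.card_univ, mul_pow,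
    absDiscr_sumElim_add] at hdet
  exact mul_left_cancel₀ (by positivity) hdet

theorem sq_det_confluentVandermonde {n : ℕ} (row : κ ≃ α ⊕ (α ⊕ β)) (col : κ ≃ Fin n)
    (x : α → ℝ) (y : β → ℝ) :
    ((confluentVandermonde n x y).submatrix row col).det ^ 2
      = absDiscr x ^ 4 * absDiscr y * (∏ l, ∏ i, |x l - y i|) ^ 4 := by
  have hcont : Continuous fun h => ((dividedVandermonde n x y h).submatrix row col).det ^ 2 :=
    (((continuous_dividedVandermonde n x y).matrix_submatrix _ _).matrix_det).pow 2
  have hlim := hcont.ext_on (dense_compl_singleton 0)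
    (g := fun h => absDiscr x * absDiscr (Sum.elim x y)
      * ∏ l, ∏ i ∈ {Sum.inl l}ᶜ, |x l + h - Sum.elim x y i| ^ 2)
    (by fun_prop) fun h hh => sq_det_dividedVandermonde row col x y hh
  have hzero := congrFun hlim 0
  simp only [dividedVandermonde_zero, add_zero, absDiscr_sumElim, prod_compl_singleton_inl,
    Sum.elim_inl, Sum.elim_inr, Finset.prod_mul_distrib, Finset.prod_pow] at hzero
  rw [hzero, absDiscr]
  ring

end ConfluentVandermonde

section MomentSpace

open Polynomial

variable {n : ℕ} {ι ι' : Type*} [Fintype ι] [Fintype ι']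

theorem integrable_of_unitInterval {μ : Measure ℝ} [IsFiniteMeasure μ]
    (h : μ (Set.Icc (0 : ℝ) 1)ᶜ = 0) {f : ℝ → ℝ} (hf : Continuous f) : Integrable f μ := by
  rw [← Measure.restrict_eq_self_of_ae_mem (s := Set.Icc (0 : ℝ) 1) (μ := μ) h]
  exact hf.continuousOn.integrableOn_compact isCompact_Icc

theorem convex_momentSpace (n : ℕ) : Convex ℝ (momentSpace n) := by
  rintro _ ⟨μ, hμ, hμ0, rfl⟩ _ ⟨ν, hν, hν0, rfl⟩ a b ha hb hab
  refine ⟨ENNReal.ofReal a • μ + ENNReal.ofReal b • ν, ⟨?_⟩, ?_, ?_⟩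
  · simp [← ENNReal.ofReal_add ha hb, hab]
  · simp [hμ0, hν0]
  · ext r
    have hint {ρ : Measure ℝ} [IsFiniteMeasure ρ] (hρ : ρ (Set.Icc (0 : ℝ) 1)ᶜ = 0) (c : ℝ) :
        Integrable (fun x : ℝ => x ^ ((r : ℕ) + 1)) (ENNReal.ofReal c • ρ) :=
      (integrable_of_unitInterval hρ (by fun_prop)).smul_measure ENNReal.ofReal_ne_top
    simp [moments, integral_add_measure (hint hμ0 a) (hint hν0 b), integral_smul_measure,
      ENNReal.toReal_ofReal, ha, hb]

/-- The vector of the first `n` moments of the signed measure with mass `w i` at each `a i`. -/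
def atomicMoments (n : ℕ) (w a : ι → ℝ) : Fin n → ℝ :=
  fun r => ∑ i, w i * a i ^ ((r : ℕ) + 1)

theorem moments_sum_atom {w : ι → ℝ} (hw : ∀ i, 0 ≤ w i) (a : ι → ℝ) :
    moments n (∑ i, atom (w i) (a i)) = atomicMoments n w a := by
  ext r
  simp only [moments, atom, atomicMoments]
  rw [integral_finsetSum_measure fun i _ =>
    (integrable_dirac (by simp)).smul_measure ENNReal.ofReal_ne_top]
  simp [integral_smul_measure, ENNReal.toReal_ofReal, hw]

theorem atomicMoments_mem_momentSpace {w a : ι → ℝ} (hw : ∀ i, 0 ≤ w i) (hw1 : ∑ i, w i = 1)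
    (ha : ∀ i, a i ∈ Set.Icc (0 : ℝ) 1) : atomicMoments n w a ∈ momentSpace n := by
  refine ⟨∑ i, atom (w i) (a i), ⟨?_⟩, ?_, (moments_sum_atom hw a).symm⟩
  · simp [atom, ← ENNReal.ofReal_sum_of_nonneg fun i _ => hw i, hw1]
  · simp only [atom, Measure.coe_finsetSum, Finset.sum_apply, Measure.smul_apply, smul_eq_mul]
    refine Finset.sum_eq_zero fun i _ => ?_
    rw [Measure.dirac_apply' _ measurableSet_Icc.compl]
    simp [Set.indicator_of_notMem, ha i]

/-- The integral of a polynomial `p` of degree at most `n` as an affine function of the first `n`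
moments of a probability measure. -/
def momentFunctional (p : ℝ[X]) (m : Fin n → ℝ) : ℝ :=
  p.coeff 0 + ∑ r : Fin n, p.coeff (r + 1) * m r

theorem eval_eq_momentFunctional {p : ℝ[X]} (hp : p.natDegree ≤ n) (x : ℝ) :
    p.eval x = momentFunctional p fun r : Fin n => x ^ ((r : ℕ) + 1) := by
  rw [eval_eq_sum_range' (Nat.lt_succ_of_le hp), Finset.sum_range_succ', Finset.sum_range, add_comm]
  simp [momentFunctional]

theorem momentFunctional_moments {p : ℝ[X]} (hp : p.natDegree ≤ n) {μ : Measure ℝ}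
    [IsProbabilityMeasure μ] (h : μ (Set.Icc (0 : ℝ) 1)ᶜ = 0) :
    momentFunctional p (moments n μ) = ∫ x, p.eval x ∂μ := by
  simp only [eval_eq_momentFunctional hp, momentFunctional, moments]
  rw [integral_add (integrable_const _) (integrable_of_unitInterval h (by fun_prop)),
    integral_finsetSum _ fun r _ => integrable_of_unitInterval h (by fun_prop)]
  simp [integral_const_mul]

theorem momentFunctional_atomicMoments {p : ℝ[X]} (hp : p.natDegree ≤ n) {w : ι → ℝ}
    (hw : ∑ i, w i = 1) (a : ι → ℝ) :
    momentFunctional p (atomicMoments n w a) = ∑ i, w i * p.eval (a i) := by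
  simp only [eval_eq_momentFunctional hp, momentFunctional, atomicMoments, mul_add,
    Finset.sum_add_distrib, ← Finset.sum_mul, hw, one_mul, Finset.mul_sum, mul_left_comm]
  rw [Finset.sum_comm]

theorem momentFunctional_nonneg {p : ℝ[X]} (hp : p.natDegree ≤ n)
    (hp_nonneg : ∀ x ∈ Set.Icc (0 : ℝ) 1, 0 ≤ p.eval x) {m : Fin n → ℝ} (hm : m ∈ momentSpace n) :
    0 ≤ momentFunctional p m := by
  obtain ⟨μ, hμ, hμ0, rfl⟩ := hm
  rw [momentFunctional_moments hp hμ0]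
  have hmem : ∀ᵐ x ∂μ, x ∈ Set.Icc (0 : ℝ) 1 := hμ0
  exact integral_nonneg_of_ae (hmem.mono hp_nonneg)

theorem isOpenMap_momentFunctional {p : ℝ[X]} (hp_pos : 0 < p.natDegree) (hp : p.natDegree ≤ n) :
    IsOpenMap (momentFunctional p : (Fin n → ℝ) → ℝ) := by
  obtain ⟨d, hd⟩ : ∃ d, p.natDegree = d + 1 := Nat.exists_eq_add_one.2 hp_pos
  let L : (Fin n → ℝ) →ₗ[ℝ] ℝ := Fintype.linearCombination ℝ fun r : Fin n => p.coeff (r + 1)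
  have hL : L ≠ 0 := by
    intro h
    have hlead : p.coeff (d + 1) = 0 := by
      simpa [L] using LinearMap.congr_fun h (Pi.single ⟨d, by omega⟩ 1)
    rw [← hd, coeff_natDegree, leadingCoeff_eq_zero] at hlead
    simp [hlead] at hp_pos
  have hcomp : (momentFunctional p : (Fin n → ℝ) → ℝ) = (p.coeff 0 + ·) ∘ L := by
    ext m
    simp [momentFunctional, L, Fintype.linearCombination_apply, mul_comm]
  rw [hcomp]
  exact (isOpenMap_add_left _).comp (L.isOpenMap_of_finiteDimensional (L.surjective hL))

theorem notMem_interior_momentSpace {p : ℝ[X]} (hp_pos : 0 < p.natDegree) (hp : p.natDegree ≤ n)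
    (hp_nonneg : ∀ x ∈ Set.Icc (0 : ℝ) 1, 0 ≤ p.eval x) {m : Fin n → ℝ}
    (hm : momentFunctional p m = 0) : m ∉ interior (momentSpace n) := by
  intro hint
  have hsub : momentFunctional p '' momentSpace n ⊆ Set.Ici 0 :=
    Set.image_subset_iff.2 fun _ => momentFunctional_nonneg hp hp_nonneg
  have hpos := interior_mono hsub <| (isOpenMap_momentFunctional hp_pos hp).image_interior_subset _
    ⟨m, hint, hm⟩
  simp at hpos

theorem atomicMoments_notMem_interior {w a : ι → ℝ} (hw : ∑ i, w i = 1) {p : ℝ[X]} (hp0 : p ≠ 0)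
    (hp : p.natDegree ≤ n) (hp_nonneg : ∀ x ∈ Set.Icc (0 : ℝ) 1, 0 ≤ p.eval x)
    (hzero : ∀ i, w i = 0 ∨ p.eval (a i) = 0) :
    atomicMoments n w a ∉ interior (momentSpace n) := by
  obtain ⟨i, -, hi⟩ := Finset.exists_ne_zero_of_sum_ne_zero (hw.trans_ne one_ne_zero)
  have hdeg : 0 < p.natDegree :=
    natDegree_pos_iff_degree_pos.2 (degree_pos_of_root hp0 ((hzero i).resolve_left hi))
  refine notMem_interior_momentSpace hdeg hp hp_nonneg ?_
  rw [momentFunctional_atomicMoments hp hw]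
  exact Finset.sum_eq_zero fun i _ => mul_eq_zero.2 (hzero i)

/-- The mass at the point `u` of the signed measure with mass `w i` at each `a i`. -/
noncomputable def massAt (w a : ι → ℝ) (u : ℝ) : ℝ :=
  ∑ i, if a i = u then w i else 0

theorem massAt_of_notMem_range (w : ι → ℝ) {a : ι → ℝ} {u : ℝ} (hu : u ∉ Set.range a) :
    massAt w a u = 0 :=
  Finset.sum_eq_zero fun i _ => if_neg fun h => hu ⟨i, h⟩

theorem massAt_of_injective (w : ι → ℝ) {a : ι → ℝ} (ha : Function.Injective a) (i : ι) :
    massAt w a (a i) = w i := by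
  classical
  simp [massAt, ha.eq_iff]

theorem massAt_ne_zero_iff {w a : ι → ℝ} (hw : ∀ i, 0 < w i) {u : ℝ} :
    massAt w a u ≠ 0 ↔ u ∈ Set.range a := by
  refine ⟨fun h => by_contra fun hu => h (massAt_of_notMem_range w hu), ?_⟩
  rintro ⟨i, rfl⟩
  refine (Finset.sum_pos' (fun j _ => ?_) ⟨i, Finset.mem_univ i, ?_⟩).ne'
  · split_ifs
    exacts [(hw j).le, le_rfl]
  · simpa using hw i

theorem range_eq_of_massAt_eq {w a : ι → ℝ} {w' a' : ι' → ℝ} (hw : ∀ i, 0 < w i)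
    (hw' : ∀ i, 0 < w' i) (h : massAt w a = massAt w' a') : Set.range a = Set.range a' := by
  ext u
  rw [← massAt_ne_zero_iff hw, ← massAt_ne_zero_iff hw', h]

theorem sum_mul_eval_lagrangeBasis (w : ι → ℝ) {a : ι → ℝ} {T : Finset ℝ} (ha : ∀ i, a i ∈ T)
    {u : ℝ} (hu : u ∈ T) :
    ∑ i, w i * (Lagrange.basis T id u).eval (a i) = massAt w a u := by
  refine Finset.sum_congr rfl fun i _ => ?_
  split_ifs with h
  · subst h
    have hself : (Lagrange.basis T id (a i)).eval (a i) = 1 :=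
      Lagrange.eval_basis_self Function.injective_id.injOn hu
    rw [hself, mul_one]
  · have hne : (Lagrange.basis T id u).eval (a i) = 0 :=
      Lagrange.eval_basis_of_ne (v := id) (Ne.symm h) (ha i)
    rw [hne, mul_zero]

theorem massAt_eq_of_atomicMoments_eq {w a : ι → ℝ} {w' a' : ι' → ℝ} (hw : ∑ i, w i = 1)
    (hw' : ∑ i, w' i = 1) {T : Finset ℝ} (hT : T.card ≤ n + 1) (ha : ∀ i, a i ∈ T)
    (ha' : ∀ i, a' i ∈ T) (h : atomicMoments n w a = atomicMoments n w' a') :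
    massAt w a = massAt w' a' := by
  ext u
  by_cases hu : u ∈ T
  · have hdeg : (Lagrange.basis T id u).natDegree ≤ n := by
      rw [natDegree_eq_of_degree_eq_some
        (Lagrange.degree_basis Function.injective_id.injOn hu)]
      omega
    rw [← sum_mul_eval_lagrangeBasis w ha hu, ← sum_mul_eval_lagrangeBasis w' ha' hu,
      ← momentFunctional_atomicMoments hdeg hw, ← momentFunctional_atomicMoments hdeg hw', h]
  · rw [massAt_of_notMem_range, massAt_of_notMem_range]
    · rintro ⟨i, rfl⟩
      exact hu (ha' i)
    · rintro ⟨i, rfl⟩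
      exact hu (ha i)

end MomentSpace

section Endpoints

variable {N : ℕ} {E : Type*}

/-- The fixed nodes of a quadrature measure on `[0,1]`: distinct, and each of them an endpoint. -/
structure IsEndpointFamily (y : E → ℝ) : Prop where
  injective : Function.Injective y
  eq_zero_or_eq_one : ∀ e, y e = 0 ∨ y e = 1

theorem IsEndpointFamily.mem_Icc {y : E → ℝ} (hy : IsEndpointFamily y) (e : E) :
    y e ∈ Set.Icc (0 : ℝ) 1 := by
  rcases hy.eq_zero_or_eq_one e with h | h <;> simp [h]

theorem IsEndpointFamily.notMem_Ioo {y : E → ℝ} (hy : IsEndpointFamily y) (e : E) :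
    y e ∉ Set.Ioo (0 : ℝ) 1 := by
  rcases hy.eq_zero_or_eq_one e with h | h <;> simp [h]

theorem IsEndpointFamily.absDiscr_eq_one [Fintype E] [DecidableEq E] {y : E → ℝ}
    (hy : IsEndpointFamily y) : absDiscr y = 1 := by
  refine Finset.prod_eq_one fun a _ => Finset.prod_eq_one fun b hb => ?_
  have hne : y b ≠ y a := hy.injective.ne (by simpa using hb)
  rcases hy.eq_zero_or_eq_one a with ha | ha <;> rcases hy.eq_zero_or_eq_one b with hb | hb <;>
    simp_all

end Endpoints

section Chart

variable {N k : ℕ} {E : Type*}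

/-- The point of the simplex with all coordinates but the last one prescribed. -/
def simplexPoint (w : Fin k → ℝ) : Fin (k + 1) → ℝ :=
  Fin.snoc (α := fun _ => ℝ) w (1 - ∑ i, w i)

theorem sum_simplexPoint (w : Fin k → ℝ) : ∑ i, simplexPoint w i = 1 := by
  simp [simplexPoint, Fin.sum_univ_castSucc]

/-- The free nodes: the first `N` coordinates of the parameter space. -/
def freeNodes (z : Fin (N + k) → ℝ) : Fin N → ℝ :=
  fun l => z (Fin.castAdd k l)

/-- The `k + 1` weights, the first `k` of which are the last `k` coordinates of the parameter
space. -/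
def weights (z : Fin (N + k) → ℝ) : Fin (k + 1) → ℝ :=
  simplexPoint fun j => z (Fin.natAdd N j)

theorem sum_weights_comp [Fintype E] (t : Fin N ⊕ E ≃ Fin (k + 1)) (z : Fin (N + k) → ℝ) :
    ∑ i, weights z (t i) = 1 := by
  rw [t.sum_comp, weights, sum_simplexPoint]

theorem weights_castSucc (z : Fin (N + k) → ℝ) (j : Fin k) :
    weights z j.castSucc = z (Fin.natAdd N j) := by
  simp [weights, simplexPoint]

theorem weights_last (z : Fin (N + k) → ℝ) :
    weights z (Fin.last k) = 1 - ∑ j, z (Fin.natAdd N j) := by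
  simp [weights, simplexPoint]

theorem ext_freeNodes_weights {z z' : Fin (N + k) → ℝ} (hx : freeNodes z = freeNodes z')
    (hw : weights z = weights z') : z = z' := by
  ext c
  refine Fin.addCases (fun l => congrFun hx l) (fun j => ?_) c
  rw [← weights_castSucc z, hw, weights_castSucc]

/-- The moments of the measure with free nodes `freeNodes z`, fixed nodes `y` and weights
`weights z`, where `t` matches the nodes with the weights. -/
def momentChart [Fintype E] (t : Fin N ⊕ E ≃ Fin (k + 1)) (y : E → ℝ) (z : Fin (N + k) → ℝ) :
    Fin (N + k) → ℝ :=
  atomicMoments (N + k) (weights z ∘ t) (Sum.elim (freeNodes z) y)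

/-- The Jacobian matrix of `momentChart`. The differences come from the last weight, which depends
on all the others. -/
def jacobianMatrix (t : Fin N ⊕ E ≃ Fin (k + 1)) (y : E → ℝ) (z : Fin (N + k) → ℝ) :
    Matrix (Fin (N + k)) (Fin (N + k)) ℝ :=
  Matrix.of fun r => Fin.addCases
    (fun l => weights z (t (.inl l)) * (((r : ℕ) + 1 : ℕ) * freeNodes z l ^ (r : ℕ)))
    (fun j => Sum.elim (freeNodes z) y (t.symm j.castSucc) ^ ((r : ℕ) + 1)
      - Sum.elim (freeNodes z) y (t.symm (Fin.last k)) ^ ((r : ℕ) + 1))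

theorem hasStrictFDerivAt_weights (z : Fin (N + k) → ℝ) (i : Fin (k + 1)) :
    HasStrictFDerivAt (fun z : Fin (N + k) → ℝ => weights z i)
      (Fin.snoc (α := fun _ => (Fin (N + k) → ℝ) →L[ℝ] ℝ)
        (fun j => ContinuousLinearMap.proj (Fin.natAdd N j))
        (-∑ j, ContinuousLinearMap.proj (Fin.natAdd N j)) i) z := by
  refine Fin.lastCases ?_ (fun j => ?_) i
  · simp only [weights_last, Fin.snoc_last]
    exact (HasStrictFDerivAt.fun_sum fun j _ => hasStrictFDerivAt_apply _ _).const_sub 1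
  · simp only [weights_castSucc, Fin.snoc_castSucc]
    exact hasStrictFDerivAt_apply _ _

theorem hasStrictFDerivAt_nodes (y : E → ℝ) (z : Fin (N + k) → ℝ) (i : Fin N ⊕ E) :
    HasStrictFDerivAt (fun z : Fin (N + k) → ℝ => Sum.elim (freeNodes z) y i)
      (Sum.elim (fun l => (ContinuousLinearMap.proj (Fin.castAdd k l) : (Fin (N + k) → ℝ) →L[ℝ] ℝ))
        (fun _ => 0) i) z := by
  rcases i with l | e
  · exact hasStrictFDerivAt_apply _ _
  · exact hasStrictFDerivAt_const _ _

theorem hasStrictFDerivAt_momentChart [Fintype E] (t : Fin N ⊕ E ≃ Fin (k + 1)) (y : E → ℝ)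
    (z : Fin (N + k) → ℝ) :
    HasStrictFDerivAt (momentChart t y)
      (Matrix.toLin' (jacobianMatrix t y z)).toContinuousLinearMap z := by
  rw [hasStrictFDerivAt_pi']
  intro r
  have hsum := HasStrictFDerivAt.fun_sum (u := Finset.univ) fun i _ =>
    (hasStrictFDerivAt_weights z (t i)).mul ((hasStrictFDerivAt_nodes y z i).pow ((r : ℕ) + 1))
  refine hsum.congr_fderiv ?_
  ext v
  simp only [_root_.sum_apply, _root_.add_apply, _root_.smul_apply, smul_eq_mul,
    ContinuousLinearMap.comp_apply, ContinuousLinearMap.proj_apply,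
    LinearMap.coe_toContinuousLinearMap', Matrix.toLin'_apply, Matrix.mulVec, dotProduct,
    Finset.sum_add_distrib, Fin.sum_univ_add]
  congr 1
  · simp [jacobianMatrix, Fintype.sum_sum_type, mul_assoc]
  · rw [← t.symm.sum_comp]
    simp [jacobianMatrix, Fin.sum_univ_castSucc, sub_mul, Finset.mul_sum,
      Finset.sum_sub_distrib, ← sub_eq_add_neg]

/-- `Fin n` with a first element added. -/
def sumUnitEquivSucc (n : ℕ) : Fin n ⊕ Unit ≃ Fin (n + 1) :=
  (Equiv.optionEquivSumPUnit (Fin n)).symm.trans (finSuccEquiv n).symm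

/-- `Fin n` with a last element added. -/
def sumUnitEquivCastSucc (n : ℕ) : Fin n ⊕ Unit ≃ Fin (n + 1) :=
  (Equiv.optionEquivSumPUnit (Fin n)).symm.trans finSuccEquivLast.symm

@[simp]
theorem sumUnitEquivSucc_inl {n : ℕ} (r : Fin n) : sumUnitEquivSucc n (.inl r) = r.succ := by
  simp [sumUnitEquivSucc]

@[simp]
theorem sumUnitEquivSucc_inr {n : ℕ} (u : Unit) : sumUnitEquivSucc n (.inr u) = 0 := by
  simp [sumUnitEquivSucc]

@[simp]
theorem sumUnitEquivCastSucc_inl {n : ℕ} (r : Fin n) :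
    sumUnitEquivCastSucc n (.inl r) = r.castSucc := by
  simp [sumUnitEquivCastSucc]

@[simp]
theorem sumUnitEquivCastSucc_inr {n : ℕ} (u : Unit) :
    sumUnitEquivCastSucc n (.inr u) = Fin.last n := by
  simp [sumUnitEquivCastSucc]

/-- The matching of the parameters, and one extra index for the last weight, with the rows of the
confluent Vandermonde matrix. -/
def borderedRow (t : Fin N ⊕ E ≃ Fin (k + 1)) : Fin (N + k) ⊕ Unit ≃ Fin N ⊕ (Fin N ⊕ E) :=
  (finSumFinEquiv.symm.sumCongr (Equiv.refl Unit)).trans <|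
    (Equiv.sumAssoc (Fin N) (Fin k) Unit).trans <|
      (Equiv.refl (Fin N)).sumCongr ((sumUnitEquivCastSucc k).trans t.symm)

@[simp]
theorem borderedRow_castAdd (t : Fin N ⊕ E ≃ Fin (k + 1)) (l : Fin N) :
    borderedRow t (.inl (Fin.castAdd k l)) = .inl l := by
  simp [borderedRow]

@[simp]
theorem borderedRow_natAdd (t : Fin N ⊕ E ≃ Fin (k + 1)) (j : Fin k) :
    borderedRow t (.inl (Fin.natAdd N j)) = .inr (t.symm j.castSucc) := by
  simp [borderedRow]

@[simp]
theorem borderedRow_inr (t : Fin N ⊕ E ≃ Fin (k + 1)) (u : Unit) :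
    borderedRow t (.inr u) = .inr (t.symm (Fin.last k)) := by
  simp [borderedRow]

theorem det_jacobianMatrix (t : Fin N ⊕ E ≃ Fin (k + 1)) (y : E → ℝ) (z : Fin (N + k) → ℝ) :
    (jacobianMatrix t y z).det = (∏ l, weights z (t (.inl l)))
      * ((confluentVandermonde (N + k + 1) (freeNodes z) y).submatrix
          (borderedRow t) (sumUnitEquivSucc (N + k))).det := by
  set B := (confluentVandermonde (N + k + 1) (freeNodes z) y).submatrix
    (borderedRow t) (sumUnitEquivSucc (N + k))
  have hcorner : B.toBlocks₂₂ = 1 := by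
    ext
    simp [B, confluentVandermonde, powerMatrix, Matrix.toBlocks₂₂]
  have hschur : (jacobianMatrix t y z).transpose = Matrix.of fun c r =>
      Fin.addCases (motive := fun _ => ℝ) (fun l => weights z (t (.inl l))) (fun _ => 1) c
        * (B.toBlocks₁₁ - B.toBlocks₁₂ * B.toBlocks₂₁) c r := by
    ext c r
    refine Fin.addCases (fun l => ?_) (fun j => ?_) c <;>
      simp [jacobianMatrix, B, confluentVandermonde, powerMatrix, Matrix.mul_apply,
        Matrix.toBlocks₁₁, Matrix.toBlocks₁₂, Matrix.toBlocks₂₁]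
  rw [← Matrix.det_transpose, hschur, Matrix.det_mul_column, ← Matrix.det_fromBlocks_one₂₂,
    ← hcorner, Matrix.fromBlocks_toBlocks, Fin.prod_univ_add]
  simp

theorem abs_det_jacobianMatrix [Fintype E] (t : Fin N ⊕ E ≃ Fin (k + 1)) {y : E → ℝ}
    (hy : IsEndpointFamily y) (z : Fin (N + k) → ℝ) :
    |(jacobianMatrix t y z).det|
      = (∏ l, |weights z (t (.inl l))|) * |vandermondeProd (freeNodes z)| ^ 4
        * ∏ l, ∏ e, |freeNodes z l - y e| ^ 2 := by
  classical
  refine (pow_left_inj₀ (abs_nonneg _) (by positivity) two_ne_zero).1 ?_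
  rw [sq_abs, det_jacobianMatrix, mul_pow, sq_det_confluentVandermonde, hy.absDiscr_eq_one,
    ← vandermondeProd_sq, ← Finset.abs_prod, mul_pow, mul_pow, sq_abs,
    ← sq_abs (vandermondeProd _)]
  simp only [Finset.prod_pow]
  ring

end Chart

section Topology

theorem isOpen_image_of_hasStrictFDerivAt {V : Type*} [NormedAddCommGroup V] [NormedSpace ℝ V]
    [FiniteDimensional ℝ V] {f : V → V} {f' : V → V →L[ℝ] V} {U : Set V} (hU : IsOpen U)
    (hf : ∀ x ∈ U, HasStrictFDerivAt f (f' x) x) (hdet : ∀ x ∈ U, (f' x).det ≠ 0) :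
    IsOpen (f '' U) := by
  have := FiniteDimensional.complete ℝ V
  rw [isOpen_iff_mem_nhds]
  rintro _ ⟨x, hx, rfl⟩
  have hequiv : HasStrictFDerivAt f
      ((f' x).toContinuousLinearEquivOfDetNeZero (hdet x hx) : V →L[ℝ] V) x := by
    rw [ContinuousLinearMap.coe_toContinuousLinearEquivOfDetNeZero]
    exact hf x hx
  rw [← hequiv.map_nhds_eq_of_equiv]
  exact Filter.image_mem_map (hU.mem_nhds hx)

/- The image is relatively closed in `V`, since a limit of points of `f '' U` is attained on the
compact set `K`, and cannot lie in `V` if it is attained outside `U`. -/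
theorem image_eq_of_isPreconnected {X Y : Type*} [TopologicalSpace X] [TopologicalSpace Y]
    [T2Space Y] {f : X → Y} {U K : Set X} {V : Set Y} (hU : U.Nonempty) (hUK : U ⊆ K)
    (hK : IsCompact K) (hf : ContinuousOn f K) (hV : IsPreconnected V) (hopen : IsOpen (f '' U))
    (hmaps : Set.MapsTo f U V) (hboundary : ∀ z ∈ K \ U, f z ∉ V) : f '' U = V := by
  refine hmaps.image_subset.antisymm (hV.subset_of_closure_inter_subset hopen ?_ ?_)
  · obtain ⟨z, hz⟩ := hU
    exact ⟨f z, hmaps hz, z, hz, rfl⟩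
  · rintro v ⟨hv, hvV⟩
    obtain ⟨z, hz, rfl⟩ :=
      closure_minimal (Set.image_mono hUK) (hK.image_of_continuousOn hf).isClosed hv
    exact ⟨z, by_contra fun hzU => hboundary z ⟨hz, hzU⟩ hvV, rfl⟩

end Topology

section Cells

variable {N k : ℕ} {E : Type*}

@[simp]
theorem freeNodes_append (x : Fin N → ℝ) (w : Fin k → ℝ) : freeNodes (Fin.append x w) = x := by
  ext l
  simp [freeNodes]

@[simp]
theorem weights_append (x : Fin N → ℝ) (w : Fin k → ℝ) :
    weights (Fin.append x w) = simplexPoint w := by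
  simp [weights]

@[fun_prop]
theorem continuous_freeNodes : Continuous (freeNodes : (Fin (N + k) → ℝ) → Fin N → ℝ) :=
  continuous_pi fun _ => continuous_apply _

@[fun_prop]
theorem continuous_weights : Continuous (weights : (Fin (N + k) → ℝ) → Fin (k + 1) → ℝ) :=
  continuous_pi fun i => continuous_iff_continuousAt.2 fun z =>
    (hasStrictFDerivAt_weights z i).continuousAt

theorem continuous_momentChart [Fintype E] (t : Fin N ⊕ E ≃ Fin (k + 1)) (y : E → ℝ) :
    Continuous (momentChart t y) :=
  continuous_iff_continuousAt.2 fun z => (hasStrictFDerivAt_momentChart t y z).continuousAt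

/-- The parameters with all free nodes in the open unit interval and all weights positive. -/
def openParams (N k : ℕ) : Set (Fin (N + k) → ℝ) :=
  {z | (∀ l, freeNodes z l ∈ Set.Ioo (0 : ℝ) 1) ∧ ∀ i, 0 < weights z i}

/-- The parameters with all free nodes in the closed unit interval and nonnegative weights. -/
def closedParams (N k : ℕ) : Set (Fin (N + k) → ℝ) :=
  {z | (∀ l, freeNodes z l ∈ Set.Icc (0 : ℝ) 1) ∧ ∀ i, 0 ≤ weights z i}

/-- The part of `openParams` on which the permutation `σ` strictly sorts the free nodes. -/
def cell (k : ℕ) (σ : Equiv.Perm (Fin N)) : Set (Fin (N + k) → ℝ) :=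
  openParams N k ∩ {z | StrictMono (freeNodes z ∘ σ)}

/-- The part of `closedParams` on which the permutation `σ` weakly sorts the free nodes. -/
def closedCell (k : ℕ) (σ : Equiv.Perm (Fin N)) : Set (Fin (N + k) → ℝ) :=
  closedParams N k ∩ {z | Monotone (freeNodes z ∘ σ)}

theorem openParams_eq_preimage :
    openParams N k = freeNodes ⁻¹' Set.univ.pi (fun _ => Set.Ioo 0 1)
      ∩ weights ⁻¹' Set.univ.pi (fun _ => Set.Ioi 0) := by
  ext z
  simp [openParams]

theorem closedParams_eq_preimage :
    closedParams N k = freeNodes ⁻¹' Set.univ.pi (fun _ => Set.Icc 0 1)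
      ∩ weights ⁻¹' Set.univ.pi (fun _ => Set.Ici 0) := by
  ext z
  simp only [closedParams, Set.mem_ofPred_eq, Set.mem_inter_iff, Set.mem_preimage,
    Set.mem_univ_pi, Set.mem_Ici]

theorem isOpen_openParams : IsOpen (openParams N k) := by
  rw [openParams_eq_preimage]
  exact ((isOpen_set_pi Set.finite_univ fun _ _ => isOpen_Ioo).preimage continuous_freeNodes).inter
    ((isOpen_set_pi Set.finite_univ fun _ _ => isOpen_Ioi).preimage continuous_weights)

theorem isCompact_closedParams : IsCompact (closedParams N k) := by
  refine (isCompact_Icc (a := (0 : Fin (N + k) → ℝ)) (b := 1)).of_isClosed_subset ?_ ?_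
  · rw [closedParams_eq_preimage]
    exact ((isClosed_set_pi fun _ _ => isClosed_Icc).preimage continuous_freeNodes).inter
      ((isClosed_set_pi fun _ _ => isClosed_Ici).preimage continuous_weights)
  · rintro z ⟨hx, hw⟩
    have hle (i : Fin (k + 1)) : weights z i ≤ 1 :=
      sum_simplexPoint _ ▸ Finset.single_le_sum (fun i _ => hw i) (Finset.mem_univ i)
    refine Set.mem_Icc.2 ⟨fun c => ?_, fun c => ?_⟩ <;>
      refine Fin.addCases (fun l => ?_) (fun j => ?_) c
    · exact (hx l).1
    · exact weights_castSucc z j ▸ hw _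
    · exact (hx l).2
    · exact weights_castSucc z j ▸ hle _

theorem isOpen_cell (σ : Equiv.Perm (Fin N)) : IsOpen (cell k σ) := by
  refine isOpen_openParams.inter ?_
  simp only [StrictMono, Set.ofPred_forall]
  exact isOpen_iInter_of_finite fun i => isOpen_iInter_of_finite fun j =>
    isOpen_iInter_of_finite fun _ => isOpen_lt (continuous_apply _) (continuous_apply _)

theorem isCompact_closedCell (σ : Equiv.Perm (Fin N)) : IsCompact (closedCell k σ) := by
  refine isCompact_closedParams.inter_right ?_
  simp only [Monotone, Set.ofPred_forall]
  exact isClosed_iInter fun i => isClosed_iInter fun j =>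
    isClosed_iInter fun _ => isClosed_le (continuous_apply _) (continuous_apply _)

theorem cell_subset_closedCell (σ : Equiv.Perm (Fin N)) : cell k σ ⊆ closedCell k σ :=
  fun _ hz => ⟨⟨fun l => Set.Ioo_subset_Icc_self (hz.1.1 l), fun i => (hz.1.2 i).le⟩,
    hz.2.monotone⟩

theorem nonempty_cell (σ : Equiv.Perm (Fin N)) : (cell k σ).Nonempty := by
  refine ⟨Fin.append (fun l => ((σ.symm l : ℕ) + 1 : ℝ) / (N + 1)) fun _ => 1 / (k + 1 : ℝ),
    ⟨fun l => ⟨?_, ?_⟩, fun i => ?_⟩, fun i j hij => ?_⟩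
  · rw [freeNodes_append]
    positivity
  · rw [freeNodes_append, div_lt_one (by positivity), add_lt_add_iff_right]
    exact_mod_cast (σ.symm l).isLt
  · rw [weights_append]
    refine Fin.lastCases ?_ (fun j => ?_) i
    · simp only [simplexPoint, Fin.snoc_last, Finset.sum_const, Finset.card_univ, Fintype.card_fin,
        nsmul_eq_mul]
      rw [mul_one_div, sub_pos, div_lt_one (by positivity)]
      exact lt_add_one _
    · simp only [simplexPoint, Fin.snoc_castSucc]
      positivity
  · have hlt : ((i : ℕ) : ℝ) < (j : ℕ) := by exact_mod_cast hij
    simp only [freeNodes_append, Function.comp_apply, Equiv.symm_apply_apply]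
    gcongr

theorem momentChart_mem_momentSpace [Fintype E] (t : Fin N ⊕ E ≃ Fin (k + 1)) {y : E → ℝ}
    (hy : IsEndpointFamily y) {z : Fin (N + k) → ℝ} (hz : z ∈ closedParams N k) :
    momentChart t y z ∈ momentSpace (N + k) := by
  refine atomicMoments_mem_momentSpace (fun i => hz.2 _) (sum_weights_comp t z) ?_
  rintro (l | e)
  exacts [hz.1 l, hy.mem_Icc e]

end Cells

section Injectivity

variable {N k : ℕ} {E : Type*} {y : E → ℝ} {z z' : Fin (N + k) → ℝ}

theorem card_add_card [Fintype E] (t : Fin N ⊕ E ≃ Fin (k + 1)) : N + Fintype.card E = k + 1 := by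
  simpa using Fintype.card_congr t

/- The two measures live on at most `N + (N + card E) = N + k + 1` points, which is why `N + k`
moments determine their masses. -/
theorem massAt_eq_of_momentChart_eq [Fintype E] (t : Fin N ⊕ E ≃ Fin (k + 1))
    (h : momentChart t y z = momentChart t y z') :
    massAt (weights z ∘ t) (Sum.elim (freeNodes z) y)
      = massAt (weights z' ∘ t) (Sum.elim (freeNodes z') y) := by
  classical
  let points : Fin N ⊕ (Fin N ⊕ E) → ℝ := Sum.elim (freeNodes z) (Sum.elim (freeNodes z') y)
  have hcard : (Finset.univ.image points).card ≤ N + k + 1 := by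
    refine Finset.card_image_le.trans_eq ?_
    simp [card_add_card t, add_assoc]
  have hmem (i) : points i ∈ Finset.univ.image points :=
    Finset.mem_image_of_mem points (Finset.mem_univ i)
  refine massAt_eq_of_atomicMoments_eq (sum_weights_comp t z) (sum_weights_comp t z') hcard ?_
    (fun i => hmem (.inr i)) h
  rintro (l | e)
  exacts [hmem (.inl l), hmem (.inr (.inr e))]

theorem range_nodes_inter_Ioo (hy : IsEndpointFamily y) (hz : z ∈ openParams N k) :
    Set.range (Sum.elim (freeNodes z) y) ∩ Set.Ioo 0 1 = Set.range (freeNodes z) := by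
  have hdisj : Set.range y ∩ Set.Ioo 0 1 = ∅ :=
    Set.disjoint_iff_inter_eq_empty.1 (Set.disjoint_left.2 (by
      rintro _ ⟨e, rfl⟩
      exact hy.notMem_Ioo e))
  rw [Set.Sum.elim_range, Set.union_inter_distrib_right, hdisj, Set.union_empty,
    Set.inter_eq_left]
  exact Set.range_subset_iff.2 hz.1

theorem injective_nodes (hy : IsEndpointFamily y) (hz : z ∈ openParams N k)
    (hx : Function.Injective (freeNodes z)) : Function.Injective (Sum.elim (freeNodes z) y) :=
  hx.sumElim hy.injective fun l e h => hy.notMem_Ioo e (h ▸ hz.1 l)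

theorem injective_freeNodes_of_mem_cell {σ : Equiv.Perm (Fin N)} (hz : z ∈ cell k σ) :
    Function.Injective (freeNodes z) :=
  (σ.injective_comp _).1 hz.2.injective

theorem freeNodes_eq_of_range_eq {σ : Equiv.Perm (Fin N)} (hz : z ∈ cell k σ) (hz' : z' ∈ cell k σ)
    (h : Set.range (freeNodes z) = Set.range (freeNodes z')) : freeNodes z = freeNodes z' := by
  refine σ.surjective.injective_comp_right ((hz.2.range_inj hz'.2).1 ?_)
  rw [σ.surjective.range_comp, σ.surjective.range_comp, h]

theorem injOn_momentChart [Fintype E] (t : Fin N ⊕ E ≃ Fin (k + 1)) (hy : IsEndpointFamily y)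
    (σ : Equiv.Perm (Fin N)) : Set.InjOn (momentChart t y) (cell k σ) := by
  intro z hz z' hz' h
  have hmass := massAt_eq_of_momentChart_eq t h
  have hrange : Set.range (freeNodes z) = Set.range (freeNodes z') := by
    rw [← range_nodes_inter_Ioo hy hz.1, ← range_nodes_inter_Ioo hy hz'.1,
      range_eq_of_massAt_eq (fun i => hz.1.2 (t i)) (fun i => hz'.1.2 (t i)) hmass]
  have hx : freeNodes z = freeNodes z' := freeNodes_eq_of_range_eq hz hz' hrange
  have hinj := injective_nodes hy hz.1 (injective_freeNodes_of_mem_cell hz)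
  refine ext_freeNodes_weights hx (t.surjective.injective_comp_right (funext fun i => ?_))
  rw [← hx] at hmass
  change (weights z ∘ t) i = (weights z' ∘ t) i
  rw [← massAt_of_injective (weights z ∘ t) hinj, hmass, massAt_of_injective _ hinj]

end Injectivity

section Boundary

open Polynomial

/-- The polynomial of degree one that vanishes at the endpoint `c` of the unit interval and is
nonnegative on the interval; only `c = 0` and `c = 1` are meaningful. -/
noncomputable def endpointFactor (c : ℝ) : ℝ[X] :=
  if c = 0 then X else 1 - X

theorem natDegree_endpointFactor (c : ℝ) : (endpointFactor c).natDegree = 1 := by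
  unfold endpointFactor
  split_ifs
  · exact natDegree_X
  · compute_degree!

theorem endpointFactor_eval_nonneg (c : ℝ) {u : ℝ} (hu : u ∈ Set.Icc (0 : ℝ) 1) :
    0 ≤ (endpointFactor c).eval u := by
  unfold endpointFactor
  split_ifs
  · simpa using hu.1
  · simpa using hu.2

theorem endpointFactor_eval_self {c : ℝ} (hc : c = 0 ∨ c = 1) : (endpointFactor c).eval c = 0 := by
  rcases hc with rfl | rfl <;> simp [endpointFactor]

variable {N k : ℕ} {E : Type*} {x : Fin N → ℝ} {y : E → ℝ}

/-- The polynomial of least degree that vanishes at the node with the given index and is nonnegative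
on the unit interval: a square for a free node, linear for an endpoint. -/
noncomputable def nodeFactor (x : Fin N → ℝ) (y : E → ℝ) : Fin N ⊕ E → ℝ[X] :=
  Sum.elim (fun l => (X - C (x l)) ^ 2) fun e => endpointFactor (y e)

theorem natDegree_nodeFactor (i : Fin N ⊕ E) :
    (nodeFactor x y i).natDegree = Sum.elim (fun _ => 2) (fun _ => 1) i := by
  rcases i with l | e
  · simp [nodeFactor, natDegree_pow]
  · exact natDegree_endpointFactor _

theorem natDegree_nodeFactor_pos (i : Fin N ⊕ E) : 0 < (nodeFactor x y i).natDegree := by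
  rcases i with l | e <;> simp [natDegree_nodeFactor]

theorem nodeFactor_ne_zero (i : Fin N ⊕ E) : nodeFactor x y i ≠ 0 :=
  ne_zero_of_natDegree_gt (natDegree_nodeFactor_pos i)

theorem nodeFactor_eval_nonneg (i : Fin N ⊕ E) {u : ℝ} (hu : u ∈ Set.Icc (0 : ℝ) 1) :
    0 ≤ (nodeFactor x y i).eval u := by
  rcases i with l | e
  · simpa [nodeFactor] using sq_nonneg _
  · exact endpointFactor_eval_nonneg _ hu

theorem nodeFactor_eval_self (hy : IsEndpointFamily y) (i : Fin N ⊕ E) :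
    (nodeFactor x y i).eval (Sum.elim x y i) = 0 := by
  rcases i with l | e
  · simp [nodeFactor]
  · exact endpointFactor_eval_self (hy.eq_zero_or_eq_one e)

variable [Fintype E] {z : Fin (N + k) → ℝ}

theorem sum_natDegree_nodeFactor (t : Fin N ⊕ E ≃ Fin (k + 1)) :
    ∑ i, (nodeFactor x y i).natDegree = N + k + 1 := by
  have hcard := card_add_card t
  simp only [natDegree_nodeFactor, Fintype.sum_sum_type, Sum.elim_inl, Sum.elim_inr,
    Finset.sum_const, Finset.card_univ, Fintype.card_fin, smul_eq_mul]
  omega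

/- The product of all node factors annihilates the measure but has degree `N + k + 1`; replacing
one factor by a polynomial `q` of smaller degree brings the degree down to `N + k`. -/
theorem momentChart_notMem_interior_of_factor (t : Fin N ⊕ E ≃ Fin (k + 1))
    (hy : IsEndpointFamily y) (j : Fin N ⊕ E) {q : ℝ[X]} (hq0 : q ≠ 0)
    (hq : q.natDegree < (nodeFactor (freeNodes z) y j).natDegree)
    (hq_nonneg : ∀ u ∈ Set.Icc (0 : ℝ) 1, 0 ≤ q.eval u)
    (hzero : weights z (t j) = 0 ∨ q.eval (Sum.elim (freeNodes z) y j) = 0 ∨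
      ∃ i ≠ j, (nodeFactor (freeNodes z) y i).eval (Sum.elim (freeNodes z) y j) = 0) :
    momentChart t y z ∉ interior (momentSpace (N + k)) := by
  classical
  let F := nodeFactor (freeNodes z) y
  have hprod : ∏ i ∈ {j}ᶜ, F i ≠ 0 := Finset.prod_ne_zero_iff.2 fun i _ => nodeFactor_ne_zero i
  have hdeg : (q * ∏ i ∈ {j}ᶜ, F i).natDegree ≤ N + k := by
    have hsum : (F j).natDegree + ∑ i ∈ {j}ᶜ, (F i).natDegree = N + k + 1 := by
      rw [← sum_natDegree_nodeFactor t, ← Finset.sum_add_sum_compl {j}, Finset.sum_singleton]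
    rw [natDegree_mul hq0 hprod, natDegree_prod _ F fun i _ => nodeFactor_ne_zero i]
    exact Nat.lt_succ_iff.1 ((Nat.add_lt_add_right hq _).trans_eq hsum)
  refine atomicMoments_notMem_interior (sum_weights_comp t z) (mul_ne_zero hq0 hprod) hdeg
    (fun u hu => ?_) fun i => ?_
  · rw [eval_mul, eval_prod]
    exact mul_nonneg (hq_nonneg u hu)
      (Finset.prod_nonneg fun i _ => nodeFactor_eval_nonneg i hu)
  · rw [eval_mul, eval_prod, mul_eq_zero]
    rcases eq_or_ne i j with rfl | hij
    · exact hzero.imp_right <| Or.imp_right fun ⟨i', hi', h⟩ =>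
        Finset.prod_eq_zero (by simpa using hi') h
    · exact .inr <| .inr <|
        Finset.prod_eq_zero (by simpa using hij) (nodeFactor_eval_self hy i)

theorem momentChart_notMem_interior_of_weight_eq_zero (t : Fin N ⊕ E ≃ Fin (k + 1))
    (hy : IsEndpointFamily y) {i : Fin (k + 1)} (hi : weights z i = 0) :
    momentChart t y z ∉ interior (momentSpace (N + k)) :=
  momentChart_notMem_interior_of_factor t hy (t.symm i) one_ne_zero
    (natDegree_one.trans_lt (natDegree_nodeFactor_pos _)) (by simp) (.inl (by simpa using hi))

theorem momentChart_notMem_interior_of_freeNode_endpoint (t : Fin N ⊕ E ≃ Fin (k + 1))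
    (hy : IsEndpointFamily y) {l : Fin N} (hl : freeNodes z l = 0 ∨ freeNodes z l = 1) :
    momentChart t y z ∉ interior (momentSpace (N + k)) :=
  momentChart_notMem_interior_of_factor t hy (.inl l) (q := endpointFactor (freeNodes z l))
    (ne_zero_of_natDegree_gt (natDegree_endpointFactor _ ▸ zero_lt_one))
    (by simp [natDegree_endpointFactor, natDegree_nodeFactor])
    (fun _ hu => endpointFactor_eval_nonneg _ hu) (.inr (.inl (endpointFactor_eval_self hl)))

theorem momentChart_notMem_interior_of_freeNodes_eq (t : Fin N ⊕ E ≃ Fin (k + 1))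
    (hy : IsEndpointFamily y) {l l' : Fin N} (hne : l ≠ l') (h : freeNodes z l = freeNodes z l') :
    momentChart t y z ∉ interior (momentSpace (N + k)) :=
  momentChart_notMem_interior_of_factor t hy (.inl l) one_ne_zero
    (natDegree_one.trans_lt (natDegree_nodeFactor_pos _)) (by simp)
    (.inr (.inr ⟨.inl l', by simpa using hne.symm, by simp [nodeFactor, h]⟩))

theorem momentChart_notMem_interior_of_mem_closedCell_diff (t : Fin N ⊕ E ≃ Fin (k + 1))
    (hy : IsEndpointFamily y) {σ : Equiv.Perm (Fin N)} (hz : z ∈ closedCell k σ \ cell k σ) :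
    momentChart t y z ∉ interior (momentSpace (N + k)) := by
  obtain ⟨⟨⟨hx, hw⟩, hmono⟩, hzc⟩ := hz
  intro hint
  have hw' (i : Fin (k + 1)) : 0 < weights z i := (hw i).lt_of_ne' fun h =>
    momentChart_notMem_interior_of_weight_eq_zero t hy h hint
  have hx' (l : Fin N) : freeNodes z l ∈ Set.Ioo (0 : ℝ) 1 :=
    ⟨(hx l).1.lt_of_ne' fun h =>
      momentChart_notMem_interior_of_freeNode_endpoint t hy (.inl h) hint,
    (hx l).2.lt_of_ne fun h =>
      momentChart_notMem_interior_of_freeNode_endpoint t hy (.inr h) hint⟩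
  have hinj : Function.Injective (freeNodes z) := fun l l' h => by_contra fun hne =>
    momentChart_notMem_interior_of_freeNodes_eq t hy hne h hint
  exact hzc ⟨⟨hx', hw'⟩, hmono.strictMono_of_injective (hinj.comp σ.injective)⟩

end Boundary

section Image

variable {N k : ℕ} {E : Type*} {y : E → ℝ}

theorem det_jacobianMatrix_ne_zero_iff (t : Fin N ⊕ E ≃ Fin (k + 1)) (hy : IsEndpointFamily y)
    {z : Fin (N + k) → ℝ} (hz : z ∈ openParams N k) :
    (jacobianMatrix t y z).det ≠ 0 ↔ Function.Injective (freeNodes z) := by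
  have : Fintype E := .ofInjective (t ∘ .inr) (t.injective.comp Sum.inr_injective)
  have hw : ∏ l, |weights z (t (.inl l))| ≠ 0 :=
    Finset.prod_ne_zero_iff.2 fun l _ => abs_ne_zero.2 (hz.2 _).ne'
  have hxy : ∏ l, ∏ e, |freeNodes z l - y e| ^ 2 ≠ 0 :=
    Finset.prod_ne_zero_iff.2 fun l _ => Finset.prod_ne_zero_iff.2 fun e _ =>
      pow_ne_zero _ (abs_ne_zero.2 (sub_ne_zero.2 fun h => hy.notMem_Ioo e (h ▸ hz.1 l)))
  rw [← abs_ne_zero, abs_det_jacobianMatrix t hy, ← vandermondeProd_ne_zero_iff,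
    mul_ne_zero_iff_right hxy, mul_ne_zero_iff_left hw, ne_eq, pow_eq_zero_iff four_ne_zero,
    abs_eq_zero]

variable [Fintype E]

theorem isOpen_image_momentChart_cell (t : Fin N ⊕ E ≃ Fin (k + 1)) (hy : IsEndpointFamily y)
    (σ : Equiv.Perm (Fin N)) : IsOpen (momentChart t y '' cell k σ) := by
  refine isOpen_image_of_hasStrictFDerivAt (isOpen_cell σ)
    (fun z _ => hasStrictFDerivAt_momentChart t y z) fun z hz => ?_
  rw [LinearMap.det_toContinuousLinearMap, LinearMap.det_toLin']
  exact (det_jacobianMatrix_ne_zero_iff t hy hz.1).2 (injective_freeNodes_of_mem_cell hz)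

theorem image_momentChart_cell (t : Fin N ⊕ E ≃ Fin (k + 1)) (hy : IsEndpointFamily y)
    (σ : Equiv.Perm (Fin N)) :
    momentChart t y '' cell k σ = interior (momentSpace (N + k)) := by
  have hopen := isOpen_image_momentChart_cell t hy σ
  refine image_eq_of_isPreconnected (nonempty_cell σ) (cell_subset_closedCell σ)
    (isCompact_closedCell σ) (continuous_momentChart t y).continuousOn
    (convex_momentSpace _).interior.isPreconnected hopen (Set.mapsTo_iff_image_subset.2 ?_)
    fun _ hz => momentChart_notMem_interior_of_mem_closedCell_diff t hy hz
  refine interior_maximal ?_ hopen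
  rintro _ ⟨z, hz, rfl⟩
  exact momentChart_mem_momentSpace t hy (cell_subset_closedCell σ hz).1

end Image

section Measure

variable {α β : Type*} [MeasurableSpace α] [MeasurableSpace β]

theorem map_withDensity_comp (μ : Measure α) {f : α → β} (hf : Measurable f) {g : β → ℝ≥0∞}
    (hg : Measurable g) : (μ.withDensity (g ∘ f)).map f = (μ.map f).withDensity g := by
  ext s hs
  rw [withDensity_apply _ hs, Measure.restrict_map hf hs, lintegral_map hg hf,
    Measure.map_apply hf hs, withDensity_apply _ (hf hs)]
  rfl

theorem hasLaw_cond_of_map_eq_smul_restrict {P : Measure α} [IsProbabilityMeasure P] {f : α → β}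
    (hf : AEMeasurable f P) {μ : Measure β} {s : Set β} {c : ℝ≥0∞}
    (h : P.map f = c • μ.restrict s) : HasLaw f (ProbabilityTheory.cond μ s) P := by
  refine ⟨hf, ?_⟩
  have hmass : c * μ s = 1 := by
    have := (Measure.isProbabilityMeasure_map hf).measure_univ
    rwa [h, Measure.smul_apply, Measure.restrict_apply_univ, smul_eq_mul] at this
  rw [h, ProbabilityTheory.cond, ENNReal.eq_inv_of_mul_eq_one_left hmass]

theorem measurePreserving_castAdd_natAdd (N k : ℕ) :
    MeasurePreserving (fun z : Fin (N + k) → ℝ =>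
      (fun l : Fin N => z (Fin.castAdd k l), fun j : Fin k => z (Fin.natAdd N j))) :=
  (volume_measurePreserving_sumPiEquivProdPi fun _ : Fin N ⊕ Fin k => ℝ).comp
    (volume_measurePreserving_piCongrLeft (fun _ => ℝ) finSumFinEquiv).symm

end Measure

section Densities

variable {N k : ℕ}

theorem measurable_jacobiWeight (β a b : ℝ) : Measurable (jacobiWeight β a b (N := N)) := by
  unfold jacobiWeight vandermondeProd
  fun_prop

theorem jacobiUnnormalized_eq_restrict_Ioo (β a b : ℝ) (N : ℕ) :
    jacobiUnnormalized β a b N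
      = (volume.restrict (Set.univ.pi fun _ => Set.Ioo 0 1)).withDensity
        fun x => ENNReal.ofReal (jacobiWeight β a b x) := by
  rw [jacobiUnnormalized]
  congr 1
  exact Measure.restrict_congr_set (Measure.pi_Ioo_ae_eq_pi_Icc (μ := fun _ : Fin N => volume)
    (f := 0) (g := 1)).symm

/-- The density of `dirichlet α` with respect to `simplexVolume`. -/
noncomputable def dirichletDensity {n : ℕ} (α w : Fin n → ℝ) : ℝ :=
  Real.Gamma (∑ i, α i) / (∏ i, Real.Gamma (α i)) * ∏ i, w i ^ (α i - 1)

theorem measurable_dirichletDensity {n : ℕ} (α : Fin n → ℝ) : Measurable (dirichletDensity α) := by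
  unfold dirichletDensity
  fun_prop

@[fun_prop]
theorem measurable_simplexPoint : Measurable (simplexPoint (k := k)) := by
  refine measurable_pi_iff.2 fun i => Fin.lastCases ?_ (fun j => ?_) i
  · simp only [simplexPoint, Fin.snoc_last]
    fun_prop
  · simp only [simplexPoint, Fin.snoc_castSucc]
    fun_prop

theorem simplexVolume_succ (k : ℕ) : simplexVolume (k + 1)
    = (volume.restrict (simplexPoint ⁻¹' Set.univ.pi fun _ => Set.Ioi 0)).map simplexPoint := by
  have hregion : simplexPoint ⁻¹' (Set.univ.pi fun _ => Set.Ioi 0)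
      = {x : Fin k → ℝ | (∀ i, 0 < x i) ∧ ∑ i, x i < 1} := by
    ext w
    simp [Set.mem_pi, Fin.forall_fin_succ', simplexPoint]
  rw [hregion]
  rfl

theorem dirichlet_eq_map (α : Fin (k + 1) → ℝ) :
    dirichlet α = ((volume.restrict (simplexPoint ⁻¹' Set.univ.pi fun _ => Set.Ioi 0)).withDensity
      fun w => ENNReal.ofReal (dirichletDensity α (simplexPoint w))).map simplexPoint := by
  rw [dirichlet, simplexVolume_succ]
  exact (map_withDensity_comp _ measurable_simplexPoint
    (measurable_dirichletDensity α).ennreal_ofReal).symm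

instance (α : Fin (k + 1) → ℝ) : SFinite (dirichlet α) := by
  rw [dirichlet_eq_map]
  infer_instance

theorem jacobiUnnormalized_prod_dirichlet (β a b : ℝ) (α : Fin (k + 1) → ℝ) :
    (jacobiUnnormalized β a b N).prod (dirichlet α)
      = ((volume.restrict (openParams N k)).withDensity fun z =>
          ENNReal.ofReal (jacobiWeight β a b (freeNodes z)) *
            ENNReal.ofReal (dirichletDensity α (weights z))).map
        fun z => (freeNodes z, weights z) := by
  have hcube : MeasurableSet (Set.univ.pi fun _ : Fin N => Set.Ioo (0 : ℝ) 1) :=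
    .univ_pi fun _ => measurableSet_Ioo
  have hsimplex : MeasurableSet (simplexPoint (k := k) ⁻¹' Set.univ.pi fun _ => Set.Ioi 0) :=
    measurable_simplexPoint (.univ_pi fun _ => measurableSet_Ioi)
  have hj : Measurable fun x : Fin N → ℝ => ENNReal.ofReal (jacobiWeight β a b x) :=
    (measurable_jacobiWeight β a b).ennreal_ofReal
  have hd : Measurable fun w : Fin k → ℝ => ENNReal.ofReal (dirichletDensity α (simplexPoint w)) :=
    ((measurable_dirichletDensity α).comp measurable_simplexPoint).ennreal_ofReal
  have hjd : Measurable fun p : (Fin N → ℝ) × (Fin k → ℝ) =>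
      ENNReal.ofReal (jacobiWeight β a b p.1) *
        ENNReal.ofReal (dirichletDensity α (simplexPoint p.2)) :=
    (hj.comp measurable_fst).mul (hd.comp measurable_snd)
  have hsplit := measurePreserving_castAdd_natAdd N k
  rw [jacobiUnnormalized_eq_restrict_Ioo, dirichlet_eq_map,
    ← Measure.map_id (μ := (volume.restrict (Set.univ.pi _)).withDensity _),
    Measure.map_prod_map _ _ measurable_id measurable_simplexPoint, prod_withDensity hj hd,
    Measure.prod_restrict, ← Measure.volume_eq_prod, ← hsplit.map_eq,
    Measure.restrict_map hsplit.measurable (hcube.prod hsimplex),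
    ← map_withDensity_comp _ hsplit.measurable hjd,
    Measure.map_map (measurable_id.prodMap measurable_simplexPoint) hsplit.measurable,
    openParams_eq_preimage]
  rfl

end Densities

section ChartVolume

variable {N k : ℕ} {E : Type*}

/-- The pull-back of Lebesgue measure under the chart: on each cell its push-forward by
`momentChart t y` is Lebesgue measure on the image of the cell. -/
noncomputable def chartVolume (t : Fin N ⊕ E ≃ Fin (k + 1)) (y : E → ℝ) :
    Measure (Fin (N + k) → ℝ) :=
  (volume.restrict (openParams N k)).withDensity
    fun z => ENNReal.ofReal |(jacobianMatrix t y z).det|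

theorem ae_mem_openParams (t : Fin N ⊕ E ≃ Fin (k + 1)) (y : E → ℝ) :
    ∀ᵐ z ∂chartVolume t y, z ∈ openParams N k :=
  (withDensity_absolutelyContinuous _ _).ae_le (ae_restrict_mem isOpen_openParams.measurableSet)

variable {y : E → ℝ}

theorem measurable_abs_det_jacobianMatrix (t : Fin N ⊕ E ≃ Fin (k + 1)) (hy : IsEndpointFamily y) :
    Measurable fun z => |(jacobianMatrix t y z).det| := by
  have : Fintype E := .ofInjective (t ∘ .inr) (t.injective.comp Sum.inr_injective)
  simp only [abs_det_jacobianMatrix t hy, vandermondeProd]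
  fun_prop

theorem pairwise_disjoint_cell : Pairwise (Function.onFun Disjoint (cell (N := N) k)) := by
  refine fun σ τ hστ => Set.disjoint_left.2 fun z hσ hτ => hστ (Equiv.ext fun l => ?_)
  have hrange : Set.range (freeNodes z ∘ σ) = Set.range (freeNodes z ∘ τ) := by
    rw [σ.surjective.range_comp, τ.surjective.range_comp]
  exact injective_freeNodes_of_mem_cell hσ (congrFun ((hσ.2.range_inj hτ.2).1 hrange) l)

theorem mem_cell_sort {z : Fin (N + k) → ℝ} (hz : z ∈ openParams N k)
    (hinj : Function.Injective (freeNodes z)) : z ∈ cell k (Tuple.sort (freeNodes z)) :=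
  ⟨hz, (Tuple.monotone_sort _).strictMono_of_injective (hinj.comp (Tuple.sort _).injective)⟩

theorem chartVolume_eq_sum (t : Fin N ⊕ E ≃ Fin (k + 1)) (hy : IsEndpointFamily y) :
    chartVolume t y = Measure.sum fun σ => (volume.restrict (cell k σ)).withDensity
      fun z => ENNReal.ofReal |(jacobianMatrix t y z).det| := by
  have hcell (σ : Equiv.Perm (Fin N)) : MeasurableSet (cell k σ) := (isOpen_cell σ).measurableSet
  have hcover : ∀ᵐ z ∂chartVolume t y, z ∈ ⋃ σ, cell k σ := by
    refine (ae_withDensity_iff (measurable_abs_det_jacobianMatrix t hy).ennreal_ofReal).2 ?_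
    filter_upwards [ae_restrict_mem isOpen_openParams.measurableSet] with z hz hdet
    refine Set.mem_iUnion.2 ⟨_, mem_cell_sort hz ((det_jacobianMatrix_ne_zero_iff t hy hz).1 ?_)⟩
    exact fun h => hdet (by rw [h, abs_zero, ENNReal.ofReal_zero])
  rw [← Measure.restrict_eq_self_of_ae_mem hcover,
    Measure.restrict_iUnion pairwise_disjoint_cell hcell]
  congr 1
  ext1 σ
  have hsub : cell k σ ⊆ openParams N k := Set.inter_subset_left
  rw [chartVolume, restrict_withDensity (hcell σ), Measure.restrict_restrict_of_subset hsub]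

variable [Fintype E]

theorem map_momentChart_cell (t : Fin N ⊕ E ≃ Fin (k + 1)) (hy : IsEndpointFamily y)
    (σ : Equiv.Perm (Fin N)) :
    ((volume.restrict (cell k σ)).withDensity
      fun z => ENNReal.ofReal |(jacobianMatrix t y z).det|).map (momentChart t y)
      = volume.restrict (momentSpace (N + k)) := by
  have harea := map_withDensity_abs_det_fderiv_eq_addHaar volume
    (isOpen_cell σ).measurableSet.nullMeasurableSet
    (fun z _ => (hasStrictFDerivAt_momentChart t y z).hasFDerivAt.hasFDerivWithinAt)
    (injOn_momentChart t hy σ)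
  simp only [LinearMap.det_toContinuousLinearMap, LinearMap.det_toLin'] at harea
  rw [harea, image_momentChart_cell t hy σ]
  exact Measure.restrict_congr_set (interior_ae_eq_of_null_frontier
    ((convex_momentSpace (N + k)).addHaar_frontier volume))

theorem map_momentChart_chartVolume (t : Fin N ⊕ E ≃ Fin (k + 1)) (hy : IsEndpointFamily y) :
    (chartVolume t y).map (momentChart t y)
      = (N.factorial : ℝ≥0∞) • volume.restrict (momentSpace (N + k)) := by
  rw [chartVolume_eq_sum t hy, Measure.map_sum (continuous_momentChart t y).aemeasurable]
  simp only [map_momentChart_cell t hy]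
  rw [Measure.sum_fintype, Finset.sum_const, Finset.card_univ, Fintype.card_perm,
    Fintype.card_fin, Nat.cast_smul_eq_nsmul]

end ChartVolume

section Law

variable {N k : ℕ} {E : Type*} [Fintype E] {y : E → ℝ} {a b : ℝ} {α : Fin (k + 1) → ℝ}

theorem jacobiWeight_four {x : Fin N → ℝ} (hx : ∀ l, x l ∈ Set.Ioo (0 : ℝ) 1)
    (hab : ∀ u ∈ Set.Ioo (0 : ℝ) 1, u ^ (b - 1) * (1 - u) ^ (a - 1) = ∏ e, |u - y e| ^ 2) :
    jacobiWeight 4 a b x = |vandermondeProd x| ^ 4 * ∏ l, ∏ e, |x l - y e| ^ 2 := by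
  rw [jacobiWeight, ← Real.rpow_natCast, Nat.cast_ofNat]
  exact congrArg _ (Finset.prod_congr rfl fun l _ => hab _ (hx l))

theorem dirichletDensity_eq (t : Fin N ⊕ E ≃ Fin (k + 1))
    (hα : ∀ i, α (t i) = Sum.elim (fun _ => 2) (fun _ => 1) i) (w : Fin (k + 1) → ℝ) :
    dirichletDensity α w = Real.Gamma (2 * N + Fintype.card E) * ∏ l, w (t (.inl l)) := by
  simp only [dirichletDensity, ← Equiv.sum_comp t α, ← Equiv.prod_comp t, hα,
    Fintype.sum_sum_type, Fintype.prod_sum_type, Sum.elim_inl, Sum.elim_inr, Real.Gamma_two,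
    Real.Gamma_one, sub_self, Real.rpow_zero, Finset.prod_const_one, div_one, mul_one]
  norm_num [mul_comm]

theorem jacobiWeight_mul_dirichletDensity (t : Fin N ⊕ E ≃ Fin (k + 1)) (hy : IsEndpointFamily y)
    (hab : ∀ u ∈ Set.Ioo (0 : ℝ) 1, u ^ (b - 1) * (1 - u) ^ (a - 1) = ∏ e, |u - y e| ^ 2)
    (hα : ∀ i, α (t i) = Sum.elim (fun _ => 2) (fun _ => 1) i)
    {z : Fin (N + k) → ℝ} (hz : z ∈ openParams N k) :
    ENNReal.ofReal (jacobiWeight 4 a b (freeNodes z)) *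
        ENNReal.ofReal (dirichletDensity α (weights z))
      = ENNReal.ofReal (Real.Gamma (2 * N + Fintype.card E)) *
        ENNReal.ofReal |(jacobianMatrix t y z).det| := by
  have hw : ∏ l, |weights z (t (.inl l))| = ∏ l, weights z (t (.inl l)) :=
    Finset.prod_congr rfl fun l _ => abs_of_pos (hz.2 _)
  rw [jacobiWeight_four hz.1 hab, dirichletDensity_eq t hα, abs_det_jacobianMatrix t hy, hw,
    ← ENNReal.ofReal_mul (by positivity),
    ← ENNReal.ofReal_mul (Real.Gamma_nonneg_of_nonneg (by positivity))]
  ring_nf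

theorem exists_jacobi_prod_dirichlet_eq_smul_map (t : Fin N ⊕ E ≃ Fin (k + 1))
    (hy : IsEndpointFamily y)
    (hab : ∀ u ∈ Set.Ioo (0 : ℝ) 1, u ^ (b - 1) * (1 - u) ^ (a - 1) = ∏ e, |u - y e| ^ 2)
    (hα : ∀ i, α (t i) = Sum.elim (fun _ => 2) (fun _ => 1) i) :
    ∃ c : ℝ≥0∞, (jacobi 4 a b N).prod (dirichlet α)
      = c • (chartVolume t y).map fun z => (freeNodes z, weights z) := by
  refine ⟨(jacobiUnnormalized 4 a b N Set.univ)⁻¹ *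
    ENNReal.ofReal (Real.Gamma (2 * N + Fintype.card E)), ?_⟩
  have hdensity : (volume.restrict (openParams N k)).withDensity (fun z =>
        ENNReal.ofReal (jacobiWeight 4 a b (freeNodes z)) *
          ENNReal.ofReal (dirichletDensity α (weights z)))
      = ENNReal.ofReal (Real.Gamma (2 * N + Fintype.card E)) • chartVolume t y := by
    rw [chartVolume, ← withDensity_smul' _ _ ENNReal.ofReal_ne_top]
    refine withDensity_congr_ae ?_
    filter_upwards [ae_restrict_mem isOpen_openParams.measurableSet] with z hz
    exact jacobiWeight_mul_dirichletDensity t hy hab hα hz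
  rw [jacobi, Measure.prod_smul_left, jacobiUnnormalized_prod_dirichlet, hdensity,
    Measure.map_smul, mul_smul]

theorem hasLaw_moments_jacobi_prod_dirichlet (t : Fin N ⊕ E ≃ Fin (k + 1))
    (hy : IsEndpointFamily y)
    (hab : ∀ u ∈ Set.Ioo (0 : ℝ) 1, u ^ (b - 1) * (1 - u) ^ (a - 1) = ∏ e, |u - y e| ^ 2)
    (hα : ∀ i, α (t i) = Sum.elim (fun _ => 2) (fun _ => 1) i)
    [IsProbabilityMeasure ((jacobi 4 a b N).prod (dirichlet α))] :
    HasLaw (fun p => moments (N + k) (∑ i, atom (p.2 (t i)) (Sum.elim p.1 y i)))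
      (uniformMoments (N + k)) ((jacobi 4 a b N).prod (dirichlet α)) := by
  obtain ⟨c, hc⟩ := exists_jacobi_prod_dirichlet_eq_smul_map t hy hab hα
  have hparam : Measurable fun z : Fin (N + k) → ℝ => (freeNodes z, weights z) := by fun_prop
  let F : (Fin N → ℝ) × (Fin (k + 1) → ℝ) → Fin (N + k) → ℝ :=
    fun p => atomicMoments (N + k) (p.2 ∘ t) (Sum.elim p.1 y)
  have hF : Measurable F := by
    unfold F atomicMoments
    simp only [Fintype.sum_sum_type, Function.comp_apply, Sum.elim_inl, Sum.elim_inr]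
    fun_prop
  have hpos : ∀ᵐ p ∂(jacobi 4 a b N).prod (dirichlet α), ∀ i, 0 < p.2 i := by
    rw [hc]
    refine Measure.ae_smul_measure ((ae_map_iff hparam.aemeasurable ?_).2 ?_) c
    · simp only [Set.ofPred_forall]
      exact .iInter fun i => measurableSet_lt measurable_const (by fun_prop)
    · filter_upwards [ae_mem_openParams t y] with z hz using hz.2
  refine (hasLaw_cond_of_map_eq_smul_restrict hF.aemeasurable (c := c * N.factorial) ?_).congr ?_
  · rw [hc, Measure.map_smul, Measure.map_map hF hparam, mul_smul,
      ← map_momentChart_chartVolume t hy]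
    rfl
  · filter_upwards [hpos] with p hp
    exact moments_sum_atom (fun i => (hp _).le) _

end Law

section Cases

variable {Ω : Type*} [MeasurableSpace Ω] {P : Measure Ω} [IsProbabilityMeasure P] {N k : ℕ}

theorem hasLaw_moments_of_hasLaw {E : Type*} [Fintype E] {y : E → ℝ} {a b : ℝ}
    {α : Fin (k + 1) → ℝ} {n : ℕ} (hn : n = N + k) (t : Fin N ⊕ E ≃ Fin (k + 1))
    (hy : IsEndpointFamily y)
    (hab : ∀ u ∈ Set.Ioo (0 : ℝ) 1, u ^ (b - 1) * (1 - u) ^ (a - 1) = ∏ e, |u - y e| ^ 2)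
    (hα : ∀ i, α (t i) = Sum.elim (fun _ => 2) (fun _ => 1) i)
    {X : Ω → Fin N → ℝ} {W : Ω → Fin (k + 1) → ℝ}
    (h : HasLaw (fun ω => (X ω, W ω)) ((jacobi 4 a b N).prod (dirichlet α)) P) :
    HasLaw (fun ω => moments n
      (∑ l, atom (W ω (t (.inl l))) (X ω l) + ∑ e, atom (W ω (t (.inr e))) (y e)))
      (uniformMoments n) P := by
  subst hn
  have := h.isProbabilityMeasure_iff.1 inferInstance
  simpa only [Fintype.sum_sum_type, Sum.elim_inl, Sum.elim_inr] using
    (hasLaw_moments_jacobi_prod_dirichlet t hy hab hα).fun_comp h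

theorem hasLaw_moments_free {X W : Ω → Fin (k + 1) → ℝ}
    (h : HasLaw (fun ω => (X ω, W ω))
      ((jacobi 4 1 1 (k + 1)).prod (dirichlet fun _ : Fin (k + 1) => 2)) P) :
    HasLaw (fun ω => moments (2 * k + 1) (∑ i, atom (W ω i) (X ω i)))
      (uniformMoments (2 * k + 1)) P := by
  have hab (u : ℝ) (_ : u ∈ Set.Ioo (0 : ℝ) 1) :
      u ^ ((1 : ℝ) - 1) * (1 - u) ^ ((1 : ℝ) - 1) = ∏ e : Empty, |u - e.elim| ^ 2 := by simp
  have := hasLaw_moments_of_hasLaw (n := 2 * k + 1) (by ring)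
    (Equiv.sumEmpty (Fin (k + 1)) Empty) ⟨Function.injective_of_subsingleton _, Empty.rec⟩ hab
    (Sum.rec (fun _ => rfl) Empty.rec) h
  simpa using this

theorem hasLaw_moments_zero {X : Ω → Fin N → ℝ} {W : Ω → Fin (N + 1) → ℝ}
    (h : HasLaw (fun ω => (X ω, W ω))
      ((jacobi 4 1 3 N).prod (dirichlet fun i : Fin (N + 1) => if i = 0 then 1 else 2)) P) :
    HasLaw (fun ω => moments (2 * N) (atom (W ω 0) 0 + ∑ i, atom (W ω i.succ) (X ω i)))
      (uniformMoments (2 * N)) P := by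
  have hab (u : ℝ) (_ : u ∈ Set.Ioo (0 : ℝ) 1) :
      u ^ ((3 : ℝ) - 1) * (1 - u) ^ ((1 : ℝ) - 1) = ∏ _e : Unit, |u - 0| ^ 2 := by norm_num
  have := hasLaw_moments_of_hasLaw (n := 2 * N) (by ring) (sumUnitEquivSucc N)
    ⟨Function.injective_of_subsingleton _, fun _ => .inl rfl⟩ hab
    (by rintro (l | e) <;> simp) h
  simpa [add_comm] using this

theorem hasLaw_moments_one {X : Ω → Fin N → ℝ} {W : Ω → Fin (N + 1) → ℝ}
    (h : HasLaw (fun ω => (X ω, W ω))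
      ((jacobi 4 3 1 N).prod
        (dirichlet fun i : Fin (N + 1) => if i = Fin.last N then 1 else 2)) P) :
    HasLaw (fun ω => moments (2 * N)
        (∑ i, atom (W ω i.castSucc) (X ω i) + atom (W ω (Fin.last N)) 1))
      (uniformMoments (2 * N)) P := by
  have hab (u : ℝ) (_ : u ∈ Set.Ioo (0 : ℝ) 1) :
      u ^ ((1 : ℝ) - 1) * (1 - u) ^ ((3 : ℝ) - 1) = ∏ _e : Unit, |u - 1| ^ 2 := by
    norm_num [abs_sub_comm u]
  have := hasLaw_moments_of_hasLaw (n := 2 * N) (by ring) (sumUnitEquivCastSucc N)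
    ⟨Function.injective_of_subsingleton _, fun _ => .inr rfl⟩ hab
    (by rintro (l | e) <;> simp [Fin.castSucc_ne_last]) h
  simpa using this

theorem hasLaw_moments_zero_one {X : Ω → Fin k → ℝ} {W : Ω → Fin (k + 2) → ℝ}
    (h : HasLaw (fun ω => (X ω, W ω))
      ((jacobi 4 3 3 k).prod
        (dirichlet fun i : Fin (k + 2) => if i = 0 ∨ i = Fin.last (k + 1) then 1 else 2)) P) :
    HasLaw (fun ω => moments (2 * k + 1)
        (atom (W ω 0) 0 + ∑ i, atom (W ω i.succ.castSucc) (X ω i)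
          + atom (W ω (Fin.last (k + 1))) 1))
      (uniformMoments (2 * k + 1)) P := by
  let t : Fin k ⊕ (Unit ⊕ Unit) ≃ Fin (k + 2) :=
    (Equiv.sumAssoc (Fin k) Unit Unit).symm.trans
      ((Equiv.sumCongr (sumUnitEquivSucc k) (Equiv.refl Unit)).trans (sumUnitEquivCastSucc (k + 1)))
  have hy : IsEndpointFamily (Sum.elim (fun _ : Unit => (0 : ℝ)) fun _ : Unit => 1) :=
    ⟨Function.Injective.sumElim (Function.injective_of_subsingleton _)
      (Function.injective_of_subsingleton _) (by simp), by simp⟩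
  have hab (u : ℝ) (_ : u ∈ Set.Ioo (0 : ℝ) 1) :
      u ^ ((3 : ℝ) - 1) * (1 - u) ^ ((3 : ℝ) - 1)
        = ∏ e, |u - Sum.elim (fun _ : Unit => (0 : ℝ)) (fun _ : Unit => 1) e| ^ 2 := by
    norm_num [abs_sub_comm u]
  have := hasLaw_moments_of_hasLaw (n := 2 * k + 1) (by ring) t hy hab
    (by rintro (l | e | e) <;> simp [t, Fin.castSucc_ne_last]) h
  simpa [t, add_comm, add_assoc, add_left_comm] using this

end Cases

end RandomMoments

open RandomMoments in
theorem theorem4p8 {Ω : Type*} [MeasurableSpace Ω] (P : Measure Ω) [IsProbabilityMeasure P]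
    (N : ℕ) (hN : 1 ≤ N) :
    -- atoms `x₁, …, x_N`
    (∀ (X : Ω → Fin N → ℝ) (W : Ω → Fin N → ℝ),
      HasLaw (fun ω => (X ω, W ω))
        ((jacobi 4 1 1 N).prod (dirichlet fun _ : Fin N => 2)) P →
      HasLaw (fun ω => moments (2 * N - 1) (∑ k : Fin N, atom (W ω k) (X ω k)))
        (uniformMoments (2 * N - 1)) P) ∧
    -- atoms `0, x₁, …, x_N`
    (∀ (X : Ω → Fin N → ℝ) (W : Ω → Fin (N + 1) → ℝ),
      HasLaw (fun ω => (X ω, W ω))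
        ((jacobi 4 1 3 N).prod
          (dirichlet fun i : Fin (N + 1) => if i = 0 then 1 else 2)) P →
      HasLaw (fun ω => moments (2 * N)
          (atom (W ω 0) 0 + ∑ k : Fin N, atom (W ω k.succ) (X ω k)))
        (uniformMoments (2 * N)) P) ∧
    -- atoms `0, x₁, …, x_{N-1}, 1`
    (∀ (X : Ω → Fin (N - 1) → ℝ) (W : Ω → Fin (N + 1) → ℝ),
      HasLaw (fun ω => (X ω, W ω))
        ((jacobi 4 3 3 (N - 1)).prod
          (dirichlet fun i : Fin (N + 1) => if i = 0 ∨ i = Fin.last N then 1 else 2)) P →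
      HasLaw (fun ω => moments (2 * N - 1)
          (atom (W ω 0) 0
            + ∑ k : Fin (N - 1), atom (W ω ⟨(k : ℕ) + 1, by omega⟩) (X ω k)
            + atom (W ω (Fin.last N)) 1))
        (uniformMoments (2 * N - 1)) P) ∧
    -- atoms `x₁, …, x_N, 1`
    (∀ (X : Ω → Fin N → ℝ) (W : Ω → Fin (N + 1) → ℝ),
      HasLaw (fun ω => (X ω, W ω))
        ((jacobi 4 3 1 N).prod
          (dirichlet fun i : Fin (N + 1) => if i = Fin.last N then 1 else 2)) P →
      HasLaw (fun ω => moments (2 * N)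
          (∑ k : Fin N, atom (W ω k.castSucc) (X ω k) + atom (W ω (Fin.last N)) 1))
        (uniformMoments (2 * N)) P) := by
  obtain ⟨k, rfl⟩ := Nat.exists_eq_add_of_le' hN
  exact ⟨fun _ _ => hasLaw_moments_free, fun _ _ => hasLaw_moments_zero,
    fun _ _ => hasLaw_moments_zero_one, fun _ _ => hasLaw_moments_one⟩
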